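/- **Definitions.** Sets are small and categories are locally small. Let $\mathbf{CAT}$ be the 2-category of categories, functors and natural transformations, and let $\mathbf{Acc}$ be the 2-category of accessible categories, accessible functors (functors preserving $\lambda$-directed colimits for some regular cardinal $\lambda$) and natural transformations. Let $\mathbf{Acc}_2$ be the following 2-category. Its objects are pairs $(\mathcal K,U)$, where $\mathcal K$ is an accessible category with all directed colimits and $U:\mathcal K\to\mathbf{Set}$ is a faithful functor preserving directed colimits, such that * (coherence) for all morphisms $h:A\to C$ and $g:B\to C$ of $\mathcal K$ and every map $f:UA\to UB$ with $U(g)\circ f=U(h)$ there is a morphism $\bar f:A\to B$ in $\mathcal K$ with $U(\bar f)=f$; * (concrete monomorphisms) every morphism $f$ of $\mathcal K$ is a monomorphism, and $U(f)$ is a monomorphism. Its 1-cells $(\mathcal K,U)\to(\mathcal K',U')$ are all functors $\mathcal K\to\mathcal K'$ preserving directed colimits (no compatibility with $U,U'$ is required), and its 2-cells are all natural transformations. **Theorem 2.5.** $\mathbf{Acc}_2$ is closed under PIE-limits (products, inserters and equifiers, as strict 2-limits) in $\mathbf{Acc}$. That is: 1. every family $(\mathcal K_i,U_i)_{i\in I}$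 of objects of $\mathbf{Acc}_2$ indexed by a set $I$ has a product in $\mathbf{Acc}_2$; 2. every pair of 1-cells $F,G:\mathcal K\to\mathcal L$ of $\mathbf{Acc}_2$ has an inserter in $\mathbf{Acc}_2$, i.e. a universal 1-cell $P:\mathcal N\to\mathcal K$ together with a 2-cell $FP\to GP$; 3. every pair of 2-cells $\varphi,\psi:F\to G$ between 1-cells $F,G:\mathcal K\to\mathcal L$ of $\mathbf{Acc}_2$ has an equifier in $\mathbf{Acc}_2$, i.e. a universal 1-cell $P:\mathcal E\to\mathcal K$ with $\varphi P=\psi P$; and in each case the limit can be chosen so that, after forgetting the functors to $\mathbf{Set}$, the same category with the same projections (and the same 2-cell, for inserters) is also the product, inserter or equifier in $\mathbf{Acc}$ and in $\mathbf{CAT}$. -/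

import Mathlib

open CategoryTheory CategoryTheory.Limits

universe w

/-- A 2-category whose objects have underlying categories, whose 1-cells are the functors between
these that belong to a prescribed class containing identities and closed under composition, and
whose 2-cells are *all* natural transformations. Here `Type w` plays the role of sets and
`Type (w + 1)` that of classes; the categories are locally small. -/
structure TwoCatOfCats : Type (w + 3) where
  /-- the objects -/
  Obj : Type (w + 2)
  /-- the underlying category of an object -/
  cat : Obj → Cat.{w, w + 1}
  /-- the functors that are 1-cells -/
  mor : ∀ {X Y : Obj}, (cat X ⥤ cat Y) → Prop
  id_mor : ∀ X : Obj, mor (𝟭 (cat X))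
  comp_mor : ∀ {X Y Z : Obj} (F : cat X ⥤ cat Y) (G : cat Y ⥤ cat Z),
    mor F → mor G → mor (F ⋙ G)

namespace TwoCatOfCats

variable (S : TwoCatOfCats.{w})

/-- `P` with the 1-cells `π i` is the (strict) 2-categorical product in `S` of the family `X`. -/
structure IsProduct {I : Type w} (X : I → S.Obj) (P : S.Obj)
    (π : ∀ i, S.cat P ⥤ S.cat (X i)) : Prop where
  mor_proj : ∀ i, S.mor (π i)
  /-- the universal property for 1-cells -/
  existsUnique_lift : ∀ (T : S.Obj) (Q : ∀ i, S.cat T ⥤ S.cat (X i)), (∀ i, S.mor (Q i)) →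
    ∃! H : S.cat T ⥤ S.cat P, S.mor H ∧ ∀ i, H ⋙ π i = Q i
  /-- the universal property for 2-cells -/
  existsUnique_lift₂ : ∀ (T : S.Obj) (H H' : S.cat T ⥤ S.cat P), S.mor H → S.mor H' →
    ∀ α : ∀ i, H ⋙ π i ⟶ H' ⋙ π i,
      ∃! β : H ⟶ H', ∀ i, Functor.whiskerRight β (π i) = α i

/-- `N` with the 1-cell `P` and the 2-cell `φ` is the (strict) inserter in `S` of `F` and `G`. -/
structure IsInserter {K L : S.Obj} (F G : S.cat K ⥤ S.cat L) (N : S.Obj)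
    (P : S.cat N ⥤ S.cat K) (φ : P ⋙ F ⟶ P ⋙ G) : Prop where
  mor_proj : S.mor P
  /-- the universal property for 1-cells; the last equation says that `φ` whiskered with `H'` is
  `ψ`, along the identification `H' ⋙ P = H` -/
  existsUnique_lift : ∀ (T : S.Obj) (H : S.cat T ⥤ S.cat K), S.mor H → ∀ ψ : H ⋙ F ⟶ H ⋙ G,
    ∃! H' : S.cat T ⥤ S.cat N, S.mor H' ∧ ∃ e : H' ⋙ P = H,
      Functor.whiskerLeft H' φ ≫ Functor.whiskerRight (eqToHom e) G =
        Functor.whiskerRight (eqToHom e) F ≫ ψ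
  /-- the universal property for 2-cells -/
  existsUnique_lift₂ : ∀ (T : S.Obj) (H H' : S.cat T ⥤ S.cat N), S.mor H → S.mor H' →
    ∀ α : H ⋙ P ⟶ H' ⋙ P,
      Functor.whiskerLeft H φ ≫ Functor.whiskerRight α G =
        Functor.whiskerRight α F ≫ Functor.whiskerLeft H' φ →
      ∃! β : H ⟶ H', Functor.whiskerRight β P = α

/-- `E` with the 1-cell `P` is the (strict) equifier in `S` of the 2-cells `φ` and `ψ`. -/
structure IsEquifier {K L : S.Obj} {F G : S.cat K ⥤ S.cat L} (φ ψ : F ⟶ G) (E : S.Obj)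
    (P : S.cat E ⥤ S.cat K) : Prop where
  mor_proj : S.mor P
  condition : Functor.whiskerLeft P φ = Functor.whiskerLeft P ψ
  /-- the universal property for 1-cells -/
  existsUnique_lift : ∀ (T : S.Obj) (H : S.cat T ⥤ S.cat K), S.mor H →
    Functor.whiskerLeft H φ = Functor.whiskerLeft H ψ →
    ∃! H' : S.cat T ⥤ S.cat E, S.mor H' ∧ H' ⋙ P = H
  /-- the universal property for 2-cells -/
  existsUnique_lift₂ : ∀ (T : S.Obj) (H H' : S.cat T ⥤ S.cat E), S.mor H → S.mor H' →
    ∀ α : H ⋙ P ⟶ H' ⋙ P, ∃! β : H ⟶ H', Functor.whiskerRight β P = α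

end TwoCatOfCats

/-- The 2-category of all (locally small) categories. -/
abbrev CAT : TwoCatOfCats.{w} where
  Obj := Cat.{w, w + 1}
  cat X := X
  mor _ := True
  id_mor _ := trivial
  comp_mor _ _ _ _ := trivial

/-- An accessible category. -/
structure AccObj : Type (w + 2) where
  /-- the underlying category -/
  cat : Cat.{w, w + 1}
  accessible : IsAccessibleCategory.{w} cat

/-- The 2-category of accessible categories, accessible functors and natural transformations. -/
abbrev ACC : TwoCatOfCats.{w} where
  Obj := AccObj.{w}
  cat := AccObj.cat
  mor F := Functor.IsAccessible.{w} F
  id_mor _ :=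
    haveI := Cardinal.fact_isRegular_aleph0.{w}
    Functor.isAccessible_of_isCardinalAccessible _ Cardinal.aleph0.{w}
  comp_mor _ _ _ _ := inferInstance

/-- An accessible category with concrete directed colimits: an accessible category with directed
(equivalently, filtered) colimits together with a faithful functor to sets preserving them. -/
structure Acc1Obj : Type (w + 2) extends AccObj.{w} where
  hasDirectedColimits : HasFilteredColimitsOfSize.{w, w} cat
  /-- the underlying set functor -/
  U : cat ⥤ Type w
  faithful : U.Faithful
  preserves : PreservesFilteredColimitsOfSize.{w, w} U

/-- Coherence: every map `f` of underlying sets that becomes a morphism `h` after composing with a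
morphism `g` is itself a morphism. -/
def Acc1Obj.IsCoherent (K : Acc1Obj.{w}) : Prop :=
  ∀ ⦃A B C : K.cat⦄ (h : A ⟶ C) (g : B ⟶ C) (f : K.U.obj A ⟶ K.U.obj B),
    f ≫ K.U.map g = K.U.map h → ∃ f' : A ⟶ B, K.U.map f' = f

/-- Every morphism is a monomorphism, and is sent by the underlying set functor to a
monomorphism. -/
def Acc1Obj.HasConcreteMonos (K : Acc1Obj.{w}) : Prop :=
  ∀ ⦃A B : K.cat⦄ (f : A ⟶ B), Mono f ∧ Mono (K.U.map f)

/-- A coherent accessible category with concrete directed colimits and concrete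
monomorphisms. -/
structure Acc2Obj : Type (w + 2) extends Acc1Obj.{w} where
  coherent : toAcc1Obj.IsCoherent
  concreteMonos : toAcc1Obj.HasConcreteMonos

/-- The 2-category of coherent accessible categories with concrete directed colimits and concrete
monomorphisms; the 1-cells are all functors preserving directed (equivalently, filtered) colimits,
with no compatibility with the underlying set functors required, and the 2-cells are all natural
transformations. -/
abbrev ACC2 : TwoCatOfCats.{w} where
  Obj := Acc2Obj.{w}
  cat K := K.cat
  mor F := PreservesFilteredColimitsOfSize.{w, w} F
  id_mor _ := ⟨fun _ _ _ => inferInstance⟩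
  comp_mor _ _ hF hG := ⟨fun J _ _ =>
    haveI := hF.preserves_filtered_colimits J
    haveI := hG.preserves_filtered_colimits J
    inferInstance⟩

/-! Coherence and injectivity make subobjects behave like subsets: a morphism into `X` factors
through another exactly when its image in `U X` is contained in the other's image (`exists_lift`).
Hence a cocone on a filtered diagram is a colimit as soon as it is jointly surjective
(`nonempty_isColimit`), directed unions of subobjects are subobjects, and every functor preserving
filtered colimits preserves such unions (`range_map_eq_iUnion`).

Accessibility thereby becomes a downward Löwenheim–Skolem property: for a regular `κ`, every subset
of `U X` of size `< κ` lies in a subobject of size `< κ`, and up to isomorphism there is only a set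
of objects of size `< κ`. This property implies accessibility (`isCardinalAccessibleCategory`), and
conversely an accessible category has it at all sufficiently large regular `κ`
(`exists_isLowenheimSkolem`). Since it holds at all large `κ`, set-many categories can be treated at
one common cardinal.

The limits are the usual ones of categories, and the property is checked on each. In a product the
subobjects are chosen componentwise; the set functor is the disjoint union of the given ones,
because infinite products of sets do not commute with directed colimits. In an inserter a small
subobject is closed under the structure map by a union of a countable chain. An equifier is closed
under subobjects because `G` sends morphisms to monomorphisms. The projections create enough
filtered colimits for the universal properties to pass from categories to both smaller 2-categories.
-/

/-- A faithful functor to sets preserving filtered colimits, from a category having them, all of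
whose morphisms are sent to injections and which is coherent. -/
structure IsCoherentConcrete {K : Type (w + 1)} [Category.{w} K] (U : K ⥤ Type w) : Prop where
  hasFilteredColimits : HasFilteredColimitsOfSize.{w, w} K
  faithful : U.Faithful
  preserves : PreservesFilteredColimitsOfSize.{w, w} U
  coherent : ∀ ⦃A B C : K⦄ (h : A ⟶ C) (g : B ⟶ C) (f : U.obj A ⟶ U.obj B),
    f ≫ U.map g = U.map h → ∃ f' : A ⟶ B, U.map f' = f
  injective : ∀ ⦃A B : K⦄ (f : A ⟶ B), Function.Injective (U.map f)

theorem Acc2Obj.isCoherentConcrete (K : Acc2Obj.{w}) : IsCoherentConcrete K.U where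
  hasFilteredColimits := K.hasDirectedColimits
  faithful := K.faithful
  preserves := K.preserves
  coherent := K.coherent
  injective _ _ f := (mono_iff_injective _).1 (K.concreteMonos f).2

/-! ### Subobjects as subsets, and directed unions -/

namespace IsCoherentConcrete

variable {K : Type (w + 1)} [Category.{w} K] {U : K ⥤ Type w} (hU : IsCoherentConcrete U)
include hU

theorem mono {A B : K} (f : A ⟶ B) : Mono f :=
  haveI := hU.faithful
  haveI : Mono (U.map f) := (mono_iff_injective _).2 (hU.injective f)
  U.mono_of_mono_map this

/-- Choosing a preimage under `g` of each `f a` gives a map of sets over `U X`; coherence lifts it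
and faithfulness gives the equation. -/
theorem exists_lift {A B X : K} (f : A ⟶ X) (g : B ⟶ X)
    (h : Set.range (U.map f) ⊆ Set.range (U.map g)) : ∃ k : A ⟶ B, k ≫ g = f := by
  have := hU.faithful
  choose s hs using fun a => h (Set.mem_range_self a)
  have e : (TypeCat.ofHom s) ≫ U.map g = U.map f := by
    ext a
    exact hs a
  obtain ⟨k, hk⟩ := hU.coherent f g (TypeCat.ofHom s) e
  exact ⟨k, U.map_injective (by rw [U.map_comp, hk, e])⟩

theorem isIso_of_surjective {A B : K} (f : A ⟶ B) (h : Function.Surjective (U.map f)) :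
    IsIso f := by
  have := hU.mono f
  obtain ⟨k, hk⟩ := hU.exists_lift (𝟙 B) f (by rw [h.range_eq]; exact Set.subset_univ _)
  exact ⟨k, by rw [← cancel_mono f, Category.assoc, hk, Category.comp_id, Category.id_comp], hk⟩

theorem hasColimitsOfShape (J : Type w) [SmallCategory J] [IsFiltered J] :
    HasColimitsOfShape J K :=
  hU.hasFilteredColimits.HasColimitsOfShape J

theorem exists_of_isColimit {J : Type w} [SmallCategory J] [IsFiltered J] {D : J ⥤ K}
    {c : Cocone D} (hc : IsColimit c) (x : U.obj c.pt) :
    ∃ j, x ∈ Set.range (U.map (c.ι.app j)) := by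
  have := hU.preserves.preserves_filtered_colimits J
  obtain ⟨j, y, hy⟩ := Types.jointly_surjective_of_isColimit (isColimitOfPreserves U hc) x
  exact ⟨j, y, hy⟩

/-- The comparison map from the actual colimit is surjective by hypothesis, and every surjective
morphism is invertible. -/
theorem nonempty_isColimit {J : Type w} [SmallCategory J] [IsFiltered J] {D : J ⥤ K}
    (c : Cocone D) (h : ∀ x : U.obj c.pt, ∃ j, x ∈ Set.range (U.map (c.ι.app j))) :
    Nonempty (IsColimit c) := by
  have := hU.hasColimitsOfShape J
  have : IsIso (colimit.desc D c) := by
    refine hU.isIso_of_surjective _ fun x => ?_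
    obtain ⟨j, y, hy⟩ := h x
    refine ⟨U.map (colimit.ι D j) y, ?_⟩
    rw [← types_comp_apply, ← U.map_comp, colimit.ι_desc]
    exact hy
  exact ⟨IsColimit.ofPointIso (r := colimit.cocone D) (t := c) (colimit.isColimit D) (i := this)⟩

section Directed

variable {ι : Type w} [Preorder ι] {A : ι → K} {X : K} (f : ∀ i, A i ⟶ X)
  (hf : Monotone fun i => Set.range (U.map (f i)))

/-- The diagram of a monotone family of subobjects. -/
noncomputable def diagram : ι ⥤ K where
  obj := A
  map {i j} u := (hU.exists_lift (f i) (f j) (hf (leOfHom u))).choose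
  map_id i := by
    have := hU.mono (f i)
    rw [← cancel_mono (f i), (hU.exists_lift (f i) (f i) subset_rfl).choose_spec, Category.id_comp]
  map_comp {i j k} u v := by
    have := hU.mono (f k)
    rw [← cancel_mono (f k), (hU.exists_lift (f i) (f k) (hf (leOfHom (u ≫ v)))).choose_spec,
      Category.assoc, (hU.exists_lift (f j) (f k) (hf (leOfHom v))).choose_spec,
      (hU.exists_lift (f i) (f j) (hf (leOfHom u))).choose_spec]

/-- The cocone on the diagram of a monotone family of subobjects. -/
noncomputable def diagramCocone : Cocone (hU.diagram f hf) where
  pt := X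
  ι :=
    { app := f
      naturality := fun i j u => by
        have h := (hU.exists_lift (f i) (f j) (hf (leOfHom u))).choose_spec
        exact h.trans (Category.comp_id _).symm }

variable [IsDirectedOrder ι] [Nonempty ι]

/-- A directed union of subobjects that exhausts the object is a colimit. -/
theorem nonempty_isColimit_diagramCocone (h : ⋃ i, Set.range (U.map (f i)) = Set.univ) :
    Nonempty (IsColimit (hU.diagramCocone f hf)) :=
  hU.nonempty_isColimit _ fun x => Set.mem_iUnion.1 (h.ge (Set.mem_univ x))

include hf in
/-- A directed union of subobjects is a subobject. -/
theorem exists_range_eq_iUnion :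
    ∃ (B : K) (g : B ⟶ X), Set.range (U.map g) = ⋃ i, Set.range (U.map (f i)) := by
  have := hU.hasColimitsOfShape ι
  obtain ⟨B, g, k, hk, hB⟩ : ∃ (B : K) (g : B ⟶ X) (k : ∀ i, A i ⟶ B), (∀ i, k i ≫ g = f i) ∧
      ∀ y, ∃ i, y ∈ Set.range (U.map (k i)) :=
    ⟨_, colimit.desc _ (hU.diagramCocone f hf), colimit.ι (hU.diagram f hf),
      fun i => colimit.ι_desc _ _, hU.exists_of_isColimit (colimit.isColimit (hU.diagram f hf))⟩
  refine ⟨B, g, Set.Subset.antisymm ?_ (Set.iUnion_subset fun i => ?_)⟩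
  · rintro _ ⟨y, rfl⟩
    obtain ⟨i, z, rfl⟩ := hB y
    refine Set.mem_iUnion.2 ⟨i, z, ?_⟩
    rw [← hk, U.map_comp]
    rfl
  · rintro _ ⟨z, rfl⟩
    refine ⟨U.map (k i) z, ?_⟩
    rw [← hk, U.map_comp]
    rfl

include hf in
/-- Functors preserving filtered colimits preserve directed unions of subobjects. -/
theorem range_map_eq_iUnion {B : K} (g : B ⟶ X)
    (hg : Set.range (U.map g) = ⋃ i, Set.range (U.map (f i)))
    {L : Type (w + 1)} [Category.{w} L] {V : L ⥤ Type w} (hV : IsCoherentConcrete V)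
    (G : K ⥤ L) (hG : PreservesFilteredColimitsOfSize.{w, w} G) :
    Set.range (V.map (G.map g)) = ⋃ i, Set.range (V.map (G.map (f i))) := by
  have hG' := hG.preserves_filtered_colimits ι
  -- The `f i` factor through `g`, so they form a directed family of subobjects of `B` exhausting
  -- `B`. This makes `B` a colimit, to which `G` applies.
  choose k hk using fun i => hU.exists_lift (f i) g
    (by rw [hg]; exact Set.subset_iUnion (fun i => Set.range (U.map (f i))) i)
  have hfk : ∀ i, Set.range (U.map (f i)) = U.map g '' Set.range (U.map (k i)) := fun i => by
    rw [← hk i, U.map_comp, ← Set.range_comp]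
    rfl
  have hk' : Monotone fun i => Set.range (U.map (k i)) := fun i j hij => by
    have h := hf hij
    simp only [hfk] at h
    exact (Set.image_subset_image_iff (hU.injective g)).1 h
  obtain ⟨hc⟩ := hU.nonempty_isColimit_diagramCocone k hk' (by
    apply Set.image_injective.2 (hU.injective g)
    rw [Set.image_iUnion, Set.image_univ, hg]
    exact Set.iUnion_congr fun i => (hfk i).symm)
  apply Set.Subset.antisymm
  · rintro _ ⟨y, rfl⟩
    obtain ⟨i, z, rfl⟩ := hV.exists_of_isColimit (isColimitOfPreserves G hc) y
    refine Set.mem_iUnion.2 ⟨i, z, ?_⟩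
    rw [← hk, G.map_comp, V.map_comp]
    rfl
  · refine Set.iUnion_subset fun i => ?_
    rintro _ ⟨z, rfl⟩
    refine ⟨V.map (G.map (k i)) z, ?_⟩
    rw [← hk i, G.map_comp, V.map_comp]
    rfl

end Directed

end IsCoherentConcrete

/-! ### Accessibility as a Löwenheim–Skolem property -/

/-- The objects whose underlying set has cardinality `< κ`. -/
def smallObjects {K : Type (w + 1)} [Category.{w} K] (U : K ⥤ Type w) (κ : Cardinal.{w}) :
    ObjectProperty K := fun A => HasCardinalLT (U.obj A) κ

/-- The downward Löwenheim–Skolem property at `κ`, and the existence of only a set of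
isomorphism classes of objects of size `< κ`. -/
structure IsLowenheimSkolem {K : Type (w + 1)} [Category.{w} K] (U : K ⥤ Type w)
    (κ : Cardinal.{w}) : Prop where
  exists_small : ∀ (X : K) (S : Set (U.obj X)), HasCardinalLT S κ →
    ∃ (A : K) (f : A ⟶ X), S ⊆ Set.range (U.map f) ∧ HasCardinalLT (U.obj A) κ
  essentiallySmall : ObjectProperty.EssentiallySmall.{w} (smallObjects U κ)

theorem HasCardinalLT.finset {S : Type w} {κ : Cardinal.{w}} (hκ : Cardinal.aleph0 ≤ κ)
    (h : HasCardinalLT S κ) : HasCardinalLT (Finset S) κ := by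
  cases finite_or_infinite S
  · exact hasCardinalLT_of_finite _ _ hκ
  · rw [hasCardinalLT_iff_cardinal_mk_lt] at h ⊢
    rwa [Cardinal.mk_finset_of_infinite]

theorem HasCardinalLT.arrow_of_preorder {ι : Type w} [Preorder ι] {κ : Cardinal.{w}}
    (hκ : Cardinal.aleph0 ≤ κ) (h : HasCardinalLT ι κ) : HasCardinalLT (Arrow ι) κ := by
  refine (hasCardinalLT_prod hκ h h).of_injective (fun a => (a.left, a.right)) ?_
  rintro ⟨a, b, u⟩ ⟨a', b', u'⟩ h
  obtain ⟨rfl, rfl⟩ := Prod.mk.inj h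
  obtain rfl : u = u' := Subsingleton.elim _ _
  rfl

/-- In a filtered category, any family of objects is dominated by a family indexed by finite
subsets which is weakly monotone. -/
theorem IsFiltered.exists_finset_family {J : Type*} [Category* J] [IsFiltered J] {S : Type*}
    (j : S → J) : ∃ φ : Finset S → J, (∀ s t, s ≤ t → Nonempty (φ s ⟶ φ t)) ∧
      ∀ x, Nonempty (j x ⟶ φ {x}) := by
  classical
  -- Recursion step: the value at `s` dominates the values already chosen at proper subsets of `s`
  -- and all `j x` with `x ∈ s`.
  have key : ∀ (s : Finset S) (ψ : ∀ t, t ⊂ s → J), ∃ m : J,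
      (∀ t ht, Nonempty (ψ t ht ⟶ m)) ∧ ∀ x ∈ s, Nonempty (j x ⟶ m) := by
    intro s ψ
    let O : Finset J :=
      (s.ssubsets.attach.image fun t => ψ t.1 (Finset.mem_ssubsets.1 t.2)) ∪ s.image j
    obtain ⟨m, hm⟩ := IsFiltered.sup_objs_exists O
    refine ⟨m, fun t ht => hm (Finset.mem_union_left _ ?_), fun x hx =>
      hm (Finset.mem_union_right _ (Finset.mem_image_of_mem _ hx))⟩
    exact Finset.mem_image.2 ⟨⟨t, Finset.mem_ssubsets.2 ht⟩, Finset.mem_attach _ _, rfl⟩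
  let φ : Finset S → J := Finset.strongInduction fun s ψ => (key s ψ).choose
  have hφ : ∀ s, φ s = (key s fun t _ => φ t).choose := fun s =>
    Finset.strongInduction_eq _ _
  refine ⟨φ, fun s t hst => ?_, fun x => ?_⟩
  · rcases hst.eq_or_lt with rfl | h
    · exact ⟨𝟙 _⟩
    · rw [hφ t]
      exact (key t fun t _ => φ t).choose_spec.1 s h
  · rw [hφ]
    exact (key {x} fun t _ => φ t).choose_spec.2 x (Finset.mem_singleton_self x)

/-- The index of accessibility is forgotten and only filteredness of the diagrams is kept. The
cardinal used later can then be any large regular one, with no sharp inequality between cardinals.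
-/
theorem exists_small_filtered_generator (K : Type (w + 1)) [Category.{w} K]
    (hK : IsAccessibleCategory.{w} K) :
    ∃ (P : ObjectProperty K) (_ : ObjectProperty.Small.{w} P), ∀ X : K,
      ∃ (J : Type w) (_ : SmallCategory J) (_ : IsFiltered J), P.colimitsOfShape J X := by
  obtain ⟨κ, _, _⟩ := hK.exists_cardinal
  obtain ⟨P, hP, h⟩ := HasCardinalFilteredGenerator.exists_small_generator K κ
  refine ⟨P, hP, fun X => ?_⟩
  obtain ⟨J, _, _, hX⟩ := h.exists_colimitsOfShape X
  exact ⟨J, inferInstance, isFiltered_of_isCardinalFiltered J κ, hX⟩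

/-- The bound is a type rather than a cardinal, so that several bounds combine as a sum or a family
before `κ` is chosen. -/
theorem exists_bound_of_small {K : Type (w + 1)} [Category.{w} K] (P : ObjectProperty K)
    [ObjectProperty.Small.{w} P]    (F : K → Type w) :
    ∃ T : Type w, ∀ κ : Cardinal.{w}, HasCardinalLT T κ → ∀ A, P A → HasCardinalLT (F A) κ :=
  ⟨Σ x : Shrink.{w} (Subtype P), F ((equivShrink _).symm x).1, fun κ h A hA => by
    refine h.of_injective (fun y => ⟨equivShrink _ ⟨A, hA⟩, cast (by simp) y⟩) fun a b hab => ?_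
    simpa using hab⟩

namespace IsCoherentConcrete

variable {K : Type (w + 1)} [Category.{w} K] {U : K ⥤ Type w} (hU : IsCoherentConcrete U)

theorem hasCardinalLT_range {A X : K} (f : A ⟶ X) {κ : Cardinal.{w}}
    (h : HasCardinalLT (U.obj A) κ) : HasCardinalLT (Set.range (U.map f)) κ :=
  h.of_surjective (Set.rangeFactorization (U.map f)) Set.rangeFactorization_surjective

include hU

theorem hasCardinalLT_of_range {A X : K} (f : A ⟶ X) {κ : Cardinal.{w}}
    (h : HasCardinalLT (Set.range (U.map f)) κ) : HasCardinalLT (U.obj A) κ :=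
  h.of_injective (Set.rangeFactorization (U.map f)) fun _ _ hab =>
    hU.injective f (congrArg Subtype.val hab)

/-- Each element of `A` lands in the image of some stage of the colimit. Fewer than `κ` stages have
a common upper bound, and `f` factors through it by comparing images. Uniqueness holds because the
legs are monomorphisms. -/
theorem isCardinalPresentable_of_small {κ : Cardinal.{w}} [Fact κ.IsRegular] {A : K}
    (hA : HasCardinalLT (U.obj A) κ) : IsCardinalPresentable A κ where
  preservesColimitOfShape J _ _ := ⟨fun {D} => ⟨fun {c} hc => ⟨by
    have := isFiltered_of_isCardinalFiltered J κ
    refine Types.FilteredColimit.isColimitOf' _ _ (fun f => ?_) (fun j f g h => ?_)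
    · change A ⟶ c.pt at f
      choose j hj using fun a => hU.exists_of_isColimit hc (U.map f a)
      obtain ⟨k, hk⟩ := hU.exists_lift f (c.ι.app (IsCardinalFiltered.max j hA)) (by
        rintro _ ⟨a, rfl⟩
        obtain ⟨y, hy⟩ := hj a
        refine ⟨U.map (D.map (IsCardinalFiltered.toMax j hA a)) y, ?_⟩
        rw [← hy, ← c.w (IsCardinalFiltered.toMax j hA a), U.map_comp]
        rfl)
      exact ⟨_, k, hk.symm⟩
    · have := hU.mono (c.ι.app j)
      refine ⟨j, 𝟙 j, ?_⟩
      have h' : f ≫ c.ι.app j = g ≫ c.ι.app j := h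
      rw [cancel_mono] at h'
      rw [h']⟩⟩⟩

/-- The Löwenheim–Skolem property implies accessibility. -/
theorem isCardinalAccessibleCategory {κ : Cardinal.{w}} [hκ : Fact κ.IsRegular]
    (h : IsLowenheimSkolem U κ) : IsCardinalAccessibleCategory K κ := by
  have := h.essentiallySmall
  have gen : (smallObjects U κ).IsCardinalFilteredGenerator κ :=
    { le_isCardinalPresentable := fun A hA => hU.isCardinalPresentable_of_small hA
      exists_colimitsOfShape := fun X => by
        -- Small subobjects are indexed by their images, which gives a poset in the small universe.
        let J := { S : Set (U.obj X) // HasCardinalLT S κ ∧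
          ∃ (A : K) (f : A ⟶ X), Set.range (U.map f) = S }
        choose A f hf using fun S : J => S.2.2
        have hmono : Monotone fun S => Set.range (U.map (f S)) := fun S T hST => by
          simp only [hf]
          exact hST
        -- By regularity the union of fewer than `κ` small images is small, hence contained in a
        -- small subobject.
        have hJ : IsCardinalFiltered J κ := isCardinalFiltered_preorder _ _ fun I S hI => by
          obtain ⟨B, g, hg, hB⟩ := h.exists_small X (⋃ i, (S i).1)
            (hasCardinalLT_iUnion _ (by rwa [hasCardinalLT_iff_cardinal_mk_lt])
              fun i => (S i).2.1)
          exact ⟨⟨Set.range (U.map g), hasCardinalLT_range g hB, B, g, rfl⟩,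
            fun i => (Set.subset_iUnion (fun i => (S i).1) i).trans hg⟩
        have := isFiltered_of_isCardinalFiltered J κ
        obtain ⟨hc⟩ := hU.nonempty_isColimit (hU.diagramCocone f hmono) fun x => by
          obtain ⟨B, g, hg, hB⟩ := h.exists_small X {x}
            (@hasCardinalLT_of_finite _ (Set.finite_singleton x) _ hκ.out.aleph0_le)
          refine ⟨⟨Set.range (U.map g), hasCardinalLT_range g hB, B, g, rfl⟩, ?_⟩
          change x ∈ Set.range (U.map (f _))
          rw [hf]
          exact hg rfl
        exact ⟨J, inferInstance, hJ, ⟨{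
          diag := _
          ι := _
          isColimit := hc
          prop_diag_obj := fun S => hU.hasCardinalLT_of_range (f S)
            (by rw [hf]; exact S.2.1) }⟩⟩ }
  have := gen.hasCardinalFilteredGenerator
  exact
    { hasColimitsOfShape := fun J _ _ =>
        have := isFiltered_of_isCardinalFiltered J κ
        hU.hasColimitsOfShape J }

theorem isAccessibleCategory {κ : Cardinal.{w}} (hκ : κ.IsRegular)
    (h : IsLowenheimSkolem U κ) : IsAccessibleCategory.{w} K :=
  haveI : Fact κ.IsRegular := ⟨hκ⟩
  ⟨κ, this, hU.isCardinalAccessibleCategory h⟩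

/-- In a filtered colimit of objects satisfying `P`, any subset of size `< κ` is contained in a
directed union of `< κ` many subobjects satisfying `P`. -/
theorem exists_directed {P : ObjectProperty K} {J : Type w} [SmallCategory J] [IsFiltered J]
    {X : K} (hX : P.colimitsOfShape J X) {κ : Cardinal.{w}} (hκ : Cardinal.aleph0 ≤ κ)
    (S : Set (U.obj X)) (hS : HasCardinalLT S κ) :
    ∃ (ι : Type w) (_ : PartialOrder ι) (_ : IsDirectedOrder ι) (_ : Nonempty ι) (A : ι → K)
      (f : ∀ i, A i ⟶ X), HasCardinalLT ι κ ∧ (Monotone fun i => Set.range (U.map (f i))) ∧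
      (∀ i, P (A i)) ∧ S ⊆ ⋃ i, Set.range (U.map (f i)) := by
  classical
  obtain ⟨p⟩ := hX
  choose j hj using fun x : S => hU.exists_of_isColimit p.isColimit x.1
  obtain ⟨φ, hφ, hjφ⟩ := IsFiltered.exists_finset_family j
  -- Only the existence of an arrow matters for comparing images, so the chosen arrows need not be
  -- compatible.
  have aux : ∀ {i k : J}, Nonempty (i ⟶ k) →
      Set.range (U.map (p.ι.app i)) ⊆ Set.range (U.map (p.ι.app k)) := by
    rintro i k ⟨u⟩ _ ⟨y, rfl⟩
    refine ⟨U.map (p.diag.map u) y, ?_⟩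
    rw [← p.w u, U.map_comp]
    rfl
  refine ⟨Finset S, inferInstance, inferInstance, inferInstance, fun s => p.diag.obj (φ s),
    fun s => p.ι.app (φ s), hS.finset hκ, fun s t hst => aux (hφ s t hst),
    fun s => p.prop_diag_obj _, fun x hx => ?_⟩
  exact Set.mem_iUnion.2 ⟨{⟨x, hx⟩}, aux (hjφ ⟨x, hx⟩) (hj ⟨x, hx⟩)⟩

/-- An accessible coherent concrete category has the Löwenheim–Skolem property at all large
enough regular cardinals. -/
theorem exists_isLowenheimSkolem (hK : IsAccessibleCategory.{w} K) :
    ∃ T : Type w, ∀ κ : Cardinal.{w}, κ.IsRegular → HasCardinalLT T κ →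
      IsLowenheimSkolem U κ := by
  obtain ⟨P, _, hP⟩ := exists_small_filtered_generator K hK
  obtain ⟨T, hT⟩ := exists_bound_of_small P U.obj
  refine ⟨T, fun κ hκ hTκ => ?_⟩
  have : Fact κ.IsRegular := ⟨hκ⟩
  refine ⟨fun X S hS => ?_, ?_⟩
  · obtain ⟨J, _, _, hX⟩ := hP X
    obtain ⟨ι, _, _, _, A, f, hι, hf, hA, hSf⟩ := hU.exists_directed hX hκ.aleph0_le S hS
    obtain ⟨B, g, hg⟩ := hU.exists_range_eq_iUnion f hf
    refine ⟨B, g, hg ▸ hSf, hU.hasCardinalLT_of_range g ?_⟩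
    rw [hg]
    exact hasCardinalLT_iUnion _ hι fun i => hasCardinalLT_range (f i) (hT κ hTκ _ (hA i))
  -- An object of size `< κ` is covered by taking its whole underlying set as the small subset. It
  -- is thus a colimit of fewer than `κ` generators, and the closure of a small class under such
  -- colimits is essentially small.
  · refine ObjectProperty.EssentiallySmall.of_le (Q := P.colimitsCardinalClosure κ)
      fun X hX => ?_
    obtain ⟨J, _, _, hXJ⟩ := hP X
    obtain ⟨ι, _, _, _, A, f, hι, hf, hA, hSf⟩ := hU.exists_directed hXJ hκ.aleph0_le Set.univ
      ((hasCardinalLT_iff_of_equiv (Equiv.Set.univ _) κ).2 hX)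
    obtain ⟨hc⟩ := hU.nonempty_isColimit_diagramCocone f hf (Set.univ_subset_iff.1 hSf)
    have := P.isClosedUnderColimitsOfShape_colimitsCardinalClosure κ ι
      (hι.arrow_of_preorder hκ.aleph0_le)
    exact (P.colimitsCardinalClosure κ).prop_of_isColimit hc
      fun i => P.le_colimitsCardinalClosure κ _ (hA i)

/-- Functors preserving filtered colimits preserve objects of size `< κ` for all large enough
regular cardinals `κ`. -/
theorem exists_small_map (hK : IsAccessibleCategory.{w} K) {L : Type (w + 1)} [Category.{w} L]
    {V : L ⥤ Type w} (hV : IsCoherentConcrete V) (G : K ⥤ L)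
    (hG : PreservesFilteredColimitsOfSize.{w, w} G) :
    ∃ T : Type w, ∀ κ : Cardinal.{w}, κ.IsRegular → HasCardinalLT T κ →
      ∀ X, HasCardinalLT (U.obj X) κ → HasCardinalLT (V.obj (G.obj X)) κ := by
  obtain ⟨P, _, hP⟩ := exists_small_filtered_generator K hK
  obtain ⟨T, hT⟩ := exists_bound_of_small P fun A => V.obj (G.obj A)
  refine ⟨T, fun κ hκ hTκ X hX => ?_⟩
  have : Fact κ.IsRegular := ⟨hκ⟩
  obtain ⟨J, _, _, hXJ⟩ := hP X
  obtain ⟨ι, _, _, _, A, f, hι, hf, hA, hSf⟩ := hU.exists_directed hXJ hκ.aleph0_le Set.univ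
    ((hasCardinalLT_iff_of_equiv (Equiv.Set.univ _) κ).2 hX)
  -- `X` itself is the union of fewer than `κ` generators, so `G X` is the union of as many images,
  -- each of size `< κ`.
  have h := hU.range_map_eq_iUnion f hf (𝟙 X) (by
    rw [Set.univ_subset_iff.1 hSf, U.map_id]
    exact Set.range_id) hV G hG
  refine hV.hasCardinalLT_of_range (G.map (𝟙 X)) ?_
  rw [h]
  exact hasCardinalLT_iUnion _ hι fun i => hasCardinalLT_range (G.map (f i)) (hT κ hTκ _ (hA i))

end IsCoherentConcrete

/-! ### Criteria for preserving filtered colimits and for concreteness -/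

/-- A filtered cocone of sets is a colimit when it is jointly surjective and elements identified in
the apex are identified at a later stage. Injective legs make the second condition trivial. -/
theorem preservesFilteredColimits_of_injective {K : Type (w + 1)} [Category.{w} K] (U : K ⥤ Type w)
    (hinj : ∀ ⦃A B : K⦄ (f : A ⟶ B), Function.Injective (U.map f))
    (hsurj : ∀ (J : Type w) [SmallCategory J] [IsFiltered J] (D : J ⥤ K) (c : Cocone D),
      IsColimit c → ∀ x : U.obj c.pt, ∃ j, x ∈ Set.range (U.map (c.ι.app j))) :
    PreservesFilteredColimitsOfSize.{w, w} U where
  preserves_filtered_colimits J _ _ := ⟨fun {D} => ⟨fun {c} hc => ⟨by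
    refine Types.FilteredColimit.isColimitOf' _ _ (fun x => ?_) (fun j x y h => ?_)
    · obtain ⟨j, y, hy⟩ := hsurj J D c hc x
      exact ⟨j, y, hy.symm⟩
    · refine ⟨j, 𝟙 j, ?_⟩
      rw [show x = y from hinj (c.ι.app j) h]⟩⟩⟩

/-- A functor that preserves filtered colimits and is conservative reflects preservation of
filtered colimits. -/
theorem preservesFilteredColimits_of_comp {T N K : Type (w + 1)} [Category.{w} T] [Category.{w} N]
    [Category.{w} K] (P : N ⥤ K) [P.ReflectsIsomorphisms] (hN : HasFilteredColimitsOfSize.{w, w} N)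
    (hP : PreservesFilteredColimitsOfSize.{w, w} P) (J : Type w) [SmallCategory J] [IsFiltered J]
    (H : T ⥤ N) (hH : PreservesColimitsOfShape J (H ⋙ P)) : PreservesColimitsOfShape J H := by
  have := hN.HasColimitsOfShape J
  have := hP.preserves_filtered_colimits J
  have := reflectsColimitsOfShape_of_reflectsIsomorphisms (J := J) (G := P)
  exact preservesColimitsOfShape_of_reflects_of_preserves H P

namespace IsCoherentConcrete

/-- Composition with a faithful functor along which morphisms over a given one can be lifted. -/
theorem comp {N K : Type (w + 1)} [Category.{w} N] [Category.{w} K] {U : K ⥤ Type w}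
    (hU : IsCoherentConcrete U) (P : N ⥤ K) [P.Faithful]
    (hN : HasFilteredColimitsOfSize.{w, w} N) (hP : PreservesFilteredColimitsOfSize.{w, w} P)
    (hlift : ∀ ⦃A B C : N⦄ (h : A ⟶ C) (g : B ⟶ C) (f : P.obj A ⟶ P.obj B),
      f ≫ P.map g = P.map h → ∃ f' : A ⟶ B, P.map f' = f) :
    IsCoherentConcrete (P ⋙ U) where
  hasFilteredColimits := hN
  faithful := haveI := hU.faithful; inferInstance
  preserves := ⟨fun J _ _ =>
    haveI := hP.preserves_filtered_colimits J
    haveI := hU.preserves.preserves_filtered_colimits J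
    inferInstance⟩
  coherent A B C h g f e := by
    have := hU.faithful
    obtain ⟨k, hk⟩ := hU.coherent (P.map h) (P.map g) f e
    obtain ⟨l, hl⟩ := hlift h g k (U.map_injective (by rw [U.map_comp, hk]; exact e))
    exact ⟨l, by rw [Functor.comp_map, hl, hk]⟩
  injective A B f := hU.injective (P.map f)

end IsCoherentConcrete

/-! ### Products -/

section Product

variable {I : Type w} {K : I → Type (w + 1)} [∀ i, Category.{w} (K i)] (U : ∀ i, K i ⥤ Type w)

/-- The disjoint union of the underlying set functors, on the product category. -/
def disjointUnion : (∀ i, K i) ⥤ Type w where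
  obj X := Σ i, (U i).obj (X i)
  map f := TypeCat.ofHom fun x => ⟨x.1, (U x.1).map (f x.1) x.2⟩
  map_id X := by
    refine ConcreteCategory.hom_ext _ _ fun x => ?_
    exact congrArg (Sigma.mk (β := fun i => (U i).obj (X i)) x.1)
      (ConcreteCategory.congr_hom ((U x.1).map_id (X x.1)) x.2)
  map_comp {X Y Z} f g := by
    refine ConcreteCategory.hom_ext _ _ fun x => ?_
    exact congrArg (Sigma.mk (β := fun i => (U i).obj (Z i)) x.1)
      (ConcreteCategory.congr_hom ((U x.1).map_comp (f x.1) (g x.1)) x.2)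

/-- The inclusion of a summand in the disjoint union. -/
def disjointUnionMk (X : ∀ i, K i) (i : I) (x : (U i).obj (X i)) : (disjointUnion U).obj X :=
  Sigma.mk i x

theorem disjointUnionMk_surjective {X : ∀ i, K i} (x : (disjointUnion U).obj X) :
    ∃ i y, disjointUnionMk U X i y = x := ⟨x.1, x.2, rfl⟩

theorem disjointUnionMk_injective (X : ∀ i, K i) (i : I) :
    Function.Injective (disjointUnionMk U X i) :=
  fun _ _ h => eq_of_heq (Sigma.mk.inj h).2

theorem disjointUnion_map_mk {X Y : ∀ i, K i} (f : X ⟶ Y) (i : I) (x : (U i).obj (X i)) :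
    (disjointUnion U).map f (disjointUnionMk U X i x) =
      disjointUnionMk U Y i ((U i).map (f i) x) := rfl

theorem pi_hasFilteredColimits (hK : ∀ i, HasFilteredColimitsOfSize.{w, w} (K i)) :
    HasFilteredColimitsOfSize.{w, w} (∀ i, K i) where
  HasColimitsOfShape J _ _ := ⟨fun D => by
    have := fun i => (hK i).HasColimitsOfShape J
    exact pi.hasColimit_of_hasColimit_comp_eval⟩

theorem pi_eval_preserves (hK : ∀ i, HasFilteredColimitsOfSize.{w, w} (K i)) (i : I) :
    PreservesFilteredColimitsOfSize.{w, w} (Pi.eval K i) where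
  preserves_filtered_colimits J _ _ := ⟨fun {D} => by
    have := fun i => (hK i).HasColimitsOfShape J
    exact preservesColimit_of_preserves_colimit_cocone
      (pi.coconeOfCoconeEvalIsColimit fun i => colimit.isColimit (D ⋙ Pi.eval K i))
      (colimit.isColimit (D ⋙ Pi.eval K i))⟩

theorem pi_preservesColimitsOfShape {T : Type (w + 1)} [Category.{w} T] (J : Type w)
    [SmallCategory J] (H : T ⥤ ∀ i, K i)
    (h : ∀ i, PreservesColimitsOfShape J (H ⋙ Pi.eval K i)) : PreservesColimitsOfShape J H :=
  ⟨fun {D} => ⟨fun {c} hc => ⟨pi.coconeOfCoconeEvalIsColimit (F := D ⋙ H)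
    (c := fun i => (H ⋙ Pi.eval K i).mapCocone c)
    fun i => isColimitOfPreserves (H ⋙ Pi.eval K i) hc⟩⟩⟩

variable {U} (hU : ∀ i, IsCoherentConcrete (U i))
include hU

theorem disjointUnion_map_injective {X Y : ∀ i, K i} (f : X ⟶ Y) :
    Function.Injective ((disjointUnion U).map f) := by
  intro x y h
  obtain ⟨i, x, rfl⟩ := disjointUnionMk_surjective U x
  obtain ⟨j, y, rfl⟩ := disjointUnionMk_surjective U y
  rw [disjointUnion_map_mk, disjointUnion_map_mk] at h
  obtain ⟨rfl, h⟩ := Sigma.mk.inj h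
  rw [(hU i).injective _ (eq_of_heq h)]

theorem isCoherentConcrete_disjointUnion : IsCoherentConcrete (disjointUnion U) where
  hasFilteredColimits := pi_hasFilteredColimits fun i => (hU i).hasFilteredColimits
  faithful := ⟨fun {X Y f g} h => by
    funext i
    have := (hU i).faithful
    apply (U i).map_injective
    ext x
    have := ConcreteCategory.congr_hom h (disjointUnionMk U X i x)
    rw [disjointUnion_map_mk, disjointUnion_map_mk] at this
    exact disjointUnionMk_injective U _ _ this⟩
  preserves := preservesFilteredColimits_of_injective _
    (fun _ _ f => disjointUnion_map_injective hU f) (by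
      intro J _ _ D c hc x
      obtain ⟨i, x, rfl⟩ := disjointUnionMk_surjective U x
      have := (pi_eval_preserves (fun i => (hU i).hasFilteredColimits) i).preserves_filtered_colimits
        J
      obtain ⟨j, y, hy⟩ := (hU i).exists_of_isColimit
        (isColimitOfPreserves (Pi.eval K i) hc) x
      exact ⟨j, disjointUnionMk U _ i y, congrArg (disjointUnionMk U _ i) hy⟩)
  coherent A B C h g f e := by
    -- Both `g` and `h` respect summands, hence so does `f`; coherence can then be applied in each
    -- component.
    have he : ∀ i (a : (U i).obj (A i)), ∃ b : (U i).obj (B i),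
        f (disjointUnionMk U A i a) = disjointUnionMk U B i b ∧
        (U i).map (g i) b = (U i).map (h i) a := by
      intro i a
      have h₁ : (disjointUnion U).map g (f (disjointUnionMk U A i a)) =
          (disjointUnion U).map h (disjointUnionMk U A i a) :=
        ConcreteCategory.congr_hom e (disjointUnionMk U A i a)
      obtain ⟨j, b, hb⟩ := disjointUnionMk_surjective U (f (disjointUnionMk U A i a))
      rw [← hb, disjointUnion_map_mk, disjointUnion_map_mk] at h₁
      obtain ⟨rfl, h₂⟩ := Sigma.mk.inj h₁
      exact ⟨b, hb.symm, eq_of_heq h₂⟩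
    choose b hb hgb using he
    have key : ∀ i, ∃ k : A i ⟶ B i, (U i).map k = TypeCat.ofHom (b i) := fun i =>
      (hU i).coherent (h i) (g i) (TypeCat.ofHom (b i)) (by
        ext a
        exact hgb i a)
    choose k hk using key
    refine ⟨k, ?_⟩
    ext a
    obtain ⟨i, a, rfl⟩ := disjointUnionMk_surjective U a
    change (disjointUnion U).map k _ = f _
    rw [disjointUnion_map_mk, hk, hb]
    rfl
  injective _ _ f := disjointUnion_map_injective hU f

theorem isAccessibleCategory_pi (hK : ∀ i, IsAccessibleCategory.{w} (K i)) :
    IsAccessibleCategory.{w} (∀ i, K i) := by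
  choose T hT using fun i => (hU i).exists_isLowenheimSkolem (hK i)
  -- The extra index `none` makes `κ` exceed `I`, so that a disjoint union over `I` of sets of size
  -- `< κ` has size `< κ`.
  obtain ⟨κ, hκ, hI⟩ := HasCardinalLT.exists_regular_cardinal_forall.{w} fun o : Option I =>
    o.elim I T
  have hLS : ∀ i, IsLowenheimSkolem (U i) κ := fun i => hT i κ hκ (hI (some i))
  have : Fact κ.IsRegular := ⟨hκ⟩
  refine (isCoherentConcrete_disjointUnion hU).isAccessibleCategory hκ ⟨fun X S hS => ?_, ?_⟩
  · choose A f hf hA using fun i => (hLS i).exists_small (X i) (disjointUnionMk U X i ⁻¹' S)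
      (hS.of_injective (fun x => ⟨disjointUnionMk U X i x.1, x.2⟩) fun x y h =>
        Subtype.ext (disjointUnionMk_injective U X i (congrArg Subtype.val h)))
    refine ⟨A, f, ?_, hasCardinalLT_sigma _ κ (hI none) hA⟩
    intro x hx
    obtain ⟨i, x, rfl⟩ := disjointUnionMk_surjective U x
    obtain ⟨a, rfl⟩ := hf i hx
    exact ⟨disjointUnionMk U A i a, rfl⟩
  · choose Q hQ hQ' using fun i => (hLS i).essentiallySmall.exists_small_le'
    refine ⟨fun X => ∀ i, Q i (X i), small_of_injective
      (f := fun X i => (⟨X.1 i, X.2 i⟩ : Subtype (Q i))) fun X Y h => ?_, fun X hX => ?_⟩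
    · ext i
      exact congrArg Subtype.val (congrFun h i)
    · choose Y hY e using fun i => hQ' i (X i)
        (hX.of_injective _ (disjointUnionMk_injective U X i))
      exact ⟨Y, hY, ⟨{
        hom := fun i => (e i).some.hom
        inv := fun i => (e i).some.inv
        hom_inv_id := funext fun i => (e i).some.hom_inv_id
        inv_hom_id := funext fun i => (e i).some.inv_hom_id }⟩⟩

end Product

/-! ### Inserters -/

section Inserter

variable {K L : Type (w + 1)} [Category.{w} K] [Category.{w} L]

/-- The inserter of two functors: objects `X` together with a morphism `F X ⟶ G X`. -/
structure Inserter (F G : K ⥤ L) where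
  /-- the underlying object -/
  obj : K
  /-- the inserted morphism -/
  str : F.obj obj ⟶ G.obj obj

namespace Inserter

variable {F G : K ⥤ L}

/-- Morphisms in the inserter. -/
@[ext]
structure Hom (X Y : Inserter F G) where
  /-- the underlying morphism -/
  hom : X.obj ⟶ Y.obj
  w : X.str ≫ G.map hom = F.map hom ≫ Y.str

instance : Category.{w} (Inserter F G) where
  Hom := Hom
  id X := ⟨𝟙 X.obj, by simp⟩
  comp f g := ⟨f.hom ≫ g.hom, by
    rw [G.map_comp, F.map_comp, ← Category.assoc, f.w, Category.assoc, g.w, Category.assoc]⟩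

@[ext]
theorem hom_ext {X Y : Inserter F G} {f g : X ⟶ Y} (h : f.hom = g.hom) : f = g := Hom.ext h

variable (F G) in
/-- The projection of the inserter. -/
def forget : Inserter F G ⥤ K where
  obj X := X.obj
  map f := f.hom

variable (F G) in
/-- The universal 2-cell of the inserter. -/
def forgetHom : forget F G ⋙ F ⟶ forget F G ⋙ G where
  app X := X.str
  naturality _ _ f := f.w.symm

instance : (forget F G).Faithful := ⟨fun h => hom_ext h⟩

instance : (forget F G).ReflectsIsomorphisms := ⟨fun {X Y} f hf => by
  have : IsIso f.hom := hf
  refine ⟨⟨inv f.hom, ?_⟩, hom_ext (IsIso.hom_inv_id f.hom), hom_ext (IsIso.inv_hom_id f.hom)⟩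
  rw [F.map_inv, G.map_inv, IsIso.comp_inv_eq, Category.assoc, f.w, IsIso.inv_hom_id_assoc]⟩

section Colimits

/-- The check, on one leg `i` of a colimit cocone, that the induced map `d` respects the structure
maps. -/
theorem map_comp_str {A C T : K} {i : A ⟶ C} {d : C ⟶ T} {m : A ⟶ T} {a : F.obj A ⟶ G.obj A}
    {c : F.obj C ⟶ G.obj C} {t : F.obj T ⟶ G.obj T} (hc : F.map i ≫ c = a ≫ G.map i)
    (hm : a ≫ G.map m = F.map m ≫ t) (h : i ≫ d = m) :
    F.map i ≫ c ≫ G.map d = F.map i ≫ F.map d ≫ t := by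
  rw [← Category.assoc, hc, Category.assoc, ← G.map_comp, h, hm, ← h, F.map_comp, Category.assoc]

variable {J : Type w} [SmallCategory J] [HasColimitsOfShape J K] [PreservesColimitsOfShape J F]
  (D : J ⥤ Inserter F G)

/-- Since `F` preserves the colimit, the structure maps of the diagram glue to a structure map on
the colimit taken in `K`. -/
theorem exists_isColimit : ∃ (c : Cocone D) (_ : IsColimit c),
    Nonempty (IsColimit ((forget F G).mapCocone c)) := by
  let E := D ⋙ forget F G
  have hF := isColimitOfPreserves F (colimit.isColimit E)
  let s : Cocone (E ⋙ F) := Cocone.mk (G.obj (colimit E))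
    (Functor.whiskerLeft D (forgetHom F G) ≫ (G.mapCocone (colimit.cocone E)).ι)
  have hs : ∀ j, F.map (colimit.ι E j) ≫ hF.desc s = (D.obj j).str ≫ G.map (colimit.ι E j) :=
    fun j => hF.fac s j
  let c : Cocone D :=
    { pt := ⟨colimit E, hF.desc s⟩
      ι :=
        { app := fun j => ⟨colimit.ι E j, (hs j).symm⟩
          naturality := fun i j u => hom_ext ((colimit.cocone E).ι.naturality u) } }
  refine ⟨c, ?_, ⟨colimit.isColimit E⟩⟩
  exact
    { desc := fun t => ⟨colimit.desc E ((forget F G).mapCocone t), hF.hom_ext fun j => by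
        exact map_comp_str (hs j) (t.ι.app j).w
          (colimit.ι_desc ((forget F G).mapCocone t) j)⟩
      fac := fun t j => hom_ext (colimit.ι_desc ((forget F G).mapCocone t) j)
      uniq := fun t m hm => hom_ext (colimit.hom_ext fun j => by
        exact (congrArg Hom.hom (hm j)).trans (colimit.ι_desc ((forget F G).mapCocone t) j).symm) }

end Colimits

theorem hasFilteredColimits (hK : HasFilteredColimitsOfSize.{w, w} K)
    (hF : PreservesFilteredColimitsOfSize.{w, w} F) :
    HasFilteredColimitsOfSize.{w, w} (Inserter F G) where
  HasColimitsOfShape J _ _ := ⟨fun D => by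
    have := hK.HasColimitsOfShape J
    have := hF.preserves_filtered_colimits J
    obtain ⟨c, hc, -⟩ := exists_isColimit D
    exact ⟨⟨c, hc⟩⟩⟩

theorem forget_preserves (hK : HasFilteredColimitsOfSize.{w, w} K)
    (hF : PreservesFilteredColimitsOfSize.{w, w} F) :
    PreservesFilteredColimitsOfSize.{w, w} (forget F G) where
  preserves_filtered_colimits J _ _ := ⟨fun {D} => by
    have := hK.HasColimitsOfShape J
    have := hF.preserves_filtered_colimits J
    obtain ⟨c, hc, ⟨hc'⟩⟩ := exists_isColimit D
    exact preservesColimit_of_preserves_colimit_cocone hc hc'⟩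

variable {U : K ⥤ Type w} {V : L ⥤ Type w} (hU : IsCoherentConcrete U) (hV : IsCoherentConcrete V)
  (hF : PreservesFilteredColimitsOfSize.{w, w} F) (hG : PreservesFilteredColimitsOfSize.{w, w} G)
include hU hV hF

/-- A morphism `f` of `K` with `f ≫ g = h` respects the structure maps: this may be tested after
composing with the monomorphism `G g`, where it follows from the compatibility of `g` and `h`. -/
theorem isCoherentConcrete : IsCoherentConcrete (forget F G ⋙ U) :=
  hU.comp _ (hasFilteredColimits hU.hasFilteredColimits hF)
    (forget_preserves hU.hasFilteredColimits hF)
    fun A B C h g (f : A.obj ⟶ B.obj) (e : f ≫ g.hom = h.hom) => by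
      refine ⟨⟨f, ?_⟩, rfl⟩
      have := hV.mono (G.map g.hom)
      rw [← cancel_mono (G.map g.hom), Category.assoc, ← G.map_comp, e, h.w, Category.assoc, g.w,
        ← Category.assoc (F.map f), ← F.map_comp, e]

include hG

omit hF in
/-- Given a small subset of `G X`, there is a small subobject `A` of `X` such that the subset is
contained in `G A`. -/
theorem exists_small_of_subset {κ : Cardinal.{w}} [hκ : Fact κ.IsRegular]
    (hLS : IsLowenheimSkolem U κ)
    (X : K) (S : Set (U.obj X)) (hS : HasCardinalLT S κ) (R : Set (V.obj (G.obj X)))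
    (hR : HasCardinalLT R κ) :
    ∃ (A : K) (f : A ⟶ X), S ⊆ Set.range (U.map f) ∧ HasCardinalLT (U.obj A) κ ∧
      R ⊆ Set.range (V.map (G.map f)) := by
  let J := { S : Set (U.obj X) // HasCardinalLT S κ ∧
    ∃ (A : K) (f : A ⟶ X), Set.range (U.map f) = S }
  choose A f hf using fun S : J => S.2.2
  have hmono : Monotone fun S => Set.range (U.map (f S)) := fun S T hST => by
    simp only [hf]
    exact hST
  have of_small : ∀ S : Set (U.obj X), HasCardinalLT S κ → ∃ T : J, S ⊆ T.1 := fun S hS => by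
    obtain ⟨B, g, hg, hB⟩ := hLS.exists_small X S hS
    exact ⟨⟨Set.range (U.map g), IsCoherentConcrete.hasCardinalLT_range g hB, B, g, rfl⟩, hg⟩
  have : Nonempty J := ⟨(of_small S hS).choose⟩
  have : IsDirectedOrder J := ⟨fun S T => by
    obtain ⟨W, hW⟩ := of_small _ (hasCardinalLT_union hκ.out.aleph0_le S.2.1 T.2.1)
    exact ⟨W, Set.subset_union_left.trans hW, Set.subset_union_right.trans hW⟩⟩
  have hun : ⋃ S, Set.range (U.map (f S)) = Set.univ := by
    refine Set.eq_univ_of_forall fun x => ?_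
    obtain ⟨W, hW⟩ := of_small {x}
      (@hasCardinalLT_of_finite _ (Set.finite_singleton x) _ hκ.out.aleph0_le)
    refine Set.mem_iUnion.2 ⟨W, ?_⟩
    rw [hf]
    exact hW rfl
  -- `X` is the directed union of its small subobjects, so `G X` is the union of their images under
  -- `G`.
  have h := hU.range_map_eq_iUnion f hmono (𝟙 X)
    (by rw [hun, U.map_id]; exact Set.range_id) hV G hG
  rw [G.map_id, V.map_id] at h
  choose s hs using fun r : R => Set.mem_iUnion.1 (h.subset (Set.mem_range_self r.1))
  -- For each `r ∈ R` one small subobject whose image under `G` contains `r` is added to `S`; by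
  -- regularity the total stays below `κ`.
  obtain ⟨B, g, hg, hB⟩ := hLS.exists_small X (S ∪ ⋃ r, Set.range (U.map (f (s r))))
    (hasCardinalLT_union hκ.out.aleph0_le hS (hasCardinalLT_iUnion _ hR fun r => by
      rw [hf]; exact (s r).2.1))
  refine ⟨B, g, Set.subset_union_left.trans hg, hB, fun r hr => ?_⟩
  obtain ⟨k, hk⟩ := hU.exists_lift (f (s ⟨r, hr⟩)) g
    (((Set.subset_iUnion (fun r => Set.range (U.map (f (s r)))) ⟨r, hr⟩).trans
      Set.subset_union_right).trans hg)
  obtain ⟨y, hy⟩ := hs ⟨r, hr⟩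
  refine ⟨V.map (G.map k) y, ?_⟩
  rw [← types_comp_apply, ← V.map_comp, ← G.map_comp, hk]
  exact hy

/-- Closing off: starting from a small subobject of `X`, it is enlarged repeatedly so that the
structure map sends `F` of each stage into `G` of the next. As `F` and `G` preserve the union of the
chain, the structure map restricts to it. -/
theorem isAccessibleCategory (hK : IsAccessibleCategory.{w} K) :
    IsAccessibleCategory.{w} (Inserter F G) := by
  obtain ⟨T₁, h₁⟩ := hU.exists_isLowenheimSkolem hK
  obtain ⟨T₂, h₂⟩ := hU.exists_small_map hK hV F hF
  -- The summand `ℕ` makes `κ` uncountable, so the union of a countable chain of small subobjects is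
  -- small.
  obtain ⟨κ, hκ, hT⟩ := HasCardinalLT.exists_regular_cardinal.{w} (T₁ ⊕ T₂ ⊕ ULift.{w} ℕ)
  have hLS := h₁ κ hκ (hT.of_injective _ Sum.inl_injective)
  have hFκ := h₂ κ hκ (hT.of_injective _ (Sum.inr_injective.comp Sum.inl_injective))
  have hω : HasCardinalLT (ULift.{w} ℕ) κ :=
    hT.of_injective _ (Sum.inr_injective.comp Sum.inr_injective)
  have : Fact κ.IsRegular := ⟨hκ⟩
  refine (isCoherentConcrete hU hV hF).isAccessibleCategory hκ ⟨fun X S hS => ?_, ?_⟩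
  · let Sub := { A : Over X.obj // HasCardinalLT (U.obj A.left) κ }
    have step : ∀ A : Sub, ∃ B : Sub,
        Set.range (U.map A.1.hom) ⊆ Set.range (U.map B.1.hom) ∧
        Set.range (V.map (F.map A.1.hom ≫ X.str)) ⊆ Set.range (V.map (G.map B.1.hom)) := by
      intro A
      obtain ⟨B, g, h₁, h₂, h₃⟩ := exists_small_of_subset hU hV hG hLS X.obj
        (Set.range (U.map A.1.hom)) (IsCoherentConcrete.hasCardinalLT_range _ A.2)
        (Set.range (V.map (F.map A.1.hom ≫ X.str)))
        (IsCoherentConcrete.hasCardinalLT_range _ (hFκ _ A.2))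
      exact ⟨⟨Over.mk g, h₂⟩, h₁, h₃⟩
    choose next hnext hnext' using step
    obtain ⟨A₀, f₀, hf₀, hA₀⟩ := hLS.exists_small X.obj S hS
    let A : ℕ → Sub := fun n => Nat.rec ⟨Over.mk f₀, hA₀⟩ (fun _ => next) n
    let f : ∀ n : ULift.{w} ℕ, (A n.down).1.left ⟶ X.obj := fun n => (A n.down).1.hom
    have hmono : Monotone fun n => Set.range (U.map (f n)) := by
      have : Monotone fun n => Set.range (U.map (A n).1.hom) :=
        monotone_nat_of_le_succ fun n => hnext (A n)
      exact fun m n hmn => this hmn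
    have : IsDirectedOrder (ULift.{w} ℕ) :=
      ⟨fun m n => ⟨⟨max m.down n.down⟩, le_max_left m.down n.down, le_max_right m.down n.down⟩⟩
    obtain ⟨B, g, hg⟩ := hU.exists_range_eq_iUnion f hmono
    have hFg := hU.range_map_eq_iUnion f hmono g hg hV F hF
    have hGg := hU.range_map_eq_iUnion f hmono g hg hV G hG
    -- An element of `F B` comes from `F` of stage `n`, and its image under the structure map then
    -- comes from `G` of stage `n + 1`.
    obtain ⟨b, hb⟩ := hV.exists_lift (F.map g ≫ X.str) (G.map g) (by
      rw [hGg, V.map_comp]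
      rintro _ ⟨y, rfl⟩
      obtain ⟨n, z, hz⟩ := Set.mem_iUnion.1 (hFg.subset (Set.mem_range_self y))
      refine Set.mem_iUnion.2 ⟨⟨n.down + 1⟩, hnext' (A n.down) ⟨z, ?_⟩⟩
      rw [V.map_comp, types_comp_apply, types_comp_apply]
      exact congrArg _ hz)
    refine ⟨⟨B, b⟩, ⟨g, hb⟩, ?_, ?_⟩
    · exact (hf₀.trans (Set.subset_iUnion (fun n => Set.range (U.map (f n))) ⟨0⟩)).trans hg.ge
    · refine hU.hasCardinalLT_of_range g ?_
      rw [hg]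
      exact hasCardinalLT_iUnion _ hω
        fun n => IsCoherentConcrete.hasCardinalLT_range _ (A n.down).2
  · obtain ⟨Q, hQ, hQ'⟩ := hLS.essentiallySmall.exists_small_le'
    refine ⟨fun X => Q X.obj, small_of_surjective
      (f := fun X : (Σ A : Subtype Q, F.obj A.1 ⟶ G.obj A.1) =>
        (⟨⟨X.1.1, X.2⟩, X.1.2⟩ : Subtype fun X : Inserter F G => Q X.obj))
      fun X => ⟨⟨⟨X.1.obj, X.2⟩, X.1.str⟩, rfl⟩, fun X hX => ?_⟩
    obtain ⟨Y, hY, ⟨e⟩⟩ := hQ' X.obj hX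
    -- The structure map is transported along `e`, so representatives of the small objects of `K`,
    -- with all their structure maps, suffice.
    let f : X ⟶ (⟨Y, F.map e.inv ≫ X.str ≫ G.map e.hom⟩ : Inserter F G) :=
      ⟨e.hom, by rw [← Category.assoc (F.map e.hom), ← F.map_comp]; simp⟩
    have : IsIso ((forget F G).map f) := inferInstanceAs (IsIso e.hom)
    have := isIso_of_reflects_iso f (forget F G)
    exact ⟨_, hY, ⟨asIso f⟩⟩

end Inserter

end Inserter

/-! ### Equifiers -/

section Equifier

variable {K L : Type (w + 1)} [Category.{w} K] [Category.{w} L] {F G : K ⥤ L} (φ ψ : F ⟶ G)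

/-- The objects at which two natural transformations agree. -/
def equifierProperty : ObjectProperty K := fun X => φ.app X = ψ.app X

theorem equifierProperty_isClosedUnderColimitsOfShape (J : Type w) [SmallCategory J]
    [PreservesColimitsOfShape J F] : (equifierProperty φ ψ).IsClosedUnderColimitsOfShape J where
  colimitsOfShape_le := by
    rintro X ⟨p⟩
    refine (isColimitOfPreserves F p.isColimit).hom_ext fun j => ?_
    have h : φ.app (p.diag.obj j) = ψ.app (p.diag.obj j) := p.prop_diag_obj j
    exact (φ.naturality (p.ι.app j)).trans
      ((congrArg (· ≫ G.map (p.ι.app j)) h).trans (ψ.naturality (p.ι.app j)).symm)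

theorem equifier_hasFilteredColimits (hK : HasFilteredColimitsOfSize.{w, w} K)
    (hF : PreservesFilteredColimitsOfSize.{w, w} F) :
    HasFilteredColimitsOfSize.{w, w} (equifierProperty φ ψ).FullSubcategory where
  HasColimitsOfShape J _ _ := by
    have := hK.HasColimitsOfShape J
    have := hF.preserves_filtered_colimits J
    have := equifierProperty_isClosedUnderColimitsOfShape φ ψ J
    infer_instance

theorem equifier_ι_preserves (hK : HasFilteredColimitsOfSize.{w, w} K)
    (hF : PreservesFilteredColimitsOfSize.{w, w} F) :
    PreservesFilteredColimitsOfSize.{w, w} (equifierProperty φ ψ).ι where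
  preserves_filtered_colimits J _ _ := by
    have := hK.HasColimitsOfShape J
    have := hF.preserves_filtered_colimits J
    have := equifierProperty_isClosedUnderColimitsOfShape φ ψ J
    infer_instance

variable {U : K ⥤ Type w} (hU : IsCoherentConcrete U)
  (hF : PreservesFilteredColimitsOfSize.{w, w} F)
include hU hF

theorem isCoherentConcrete_equifier : IsCoherentConcrete ((equifierProperty φ ψ).ι ⋙ U) :=
  hU.comp _ (equifier_hasFilteredColimits φ ψ hU.hasFilteredColimits hF)
    (equifier_ι_preserves φ ψ hU.hasFilteredColimits hF)
    fun _ _ _ _ _ f _ => ⟨ObjectProperty.homMk f, rfl⟩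

/-- For `f : A ⟶ X` with `X` in the equifier, naturality makes `φ` and `ψ` at `A` agree after
composing with the monomorphism `G f`. Small subobjects found in `K` therefore already lie in the
equifier. -/
theorem isAccessibleCategory_equifier {V : L ⥤ Type w} (hV : IsCoherentConcrete V)
    (hK : IsAccessibleCategory.{w} K) :
    IsAccessibleCategory.{w} (equifierProperty φ ψ).FullSubcategory := by
  obtain ⟨T, hT⟩ := hU.exists_isLowenheimSkolem hK
  obtain ⟨κ, hκ, hTκ⟩ := HasCardinalLT.exists_regular_cardinal.{w} T
  have hLS := hT κ hκ hTκ
  refine (isCoherentConcrete_equifier φ ψ hU hF).isAccessibleCategory hκ ⟨fun X S hS => ?_, ?_⟩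
  · obtain ⟨A, f, hf, hA⟩ := hLS.exists_small X.obj S hS
    have hA' : equifierProperty φ ψ A := by
      have := hV.mono (G.map f)
      rw [equifierProperty, ← cancel_mono (G.map f), ← φ.naturality, ← ψ.naturality]
      exact congrArg _ X.property
    exact ⟨⟨A, hA'⟩, ObjectProperty.homMk f, hf, hA⟩
  · have := hLS.essentiallySmall
    have : ObjectProperty.EssentiallySmall.{w} (smallObjects U κ ⊓ equifierProperty φ ψ) :=
      ObjectProperty.EssentiallySmall.of_le inf_le_left
    obtain ⟨Q, _, hQ, hQ'⟩ :=
      ObjectProperty.EssentiallySmall.exists_small_le.{w} (smallObjects U κ ⊓ equifierProperty φ ψ)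
    refine ⟨fun X => Q X.obj, small_of_injective (f := fun X => (⟨X.1.obj, X.2⟩ : Subtype Q))
      fun X Y h => ?_, fun X hX => ?_⟩
    · exact Subtype.ext (ObjectProperty.FullSubcategory.ext (congrArg Subtype.val h))
    · obtain ⟨Y, hY, ⟨e⟩⟩ := hQ' X.obj ⟨hX, X.property⟩
      exact ⟨⟨Y, (hQ Y hY).2⟩, hY, ⟨ObjectProperty.isoMk _ e⟩⟩

end Equifier

namespace TwoCatOfCats

/-! ### Transfer of limits from the 2-category of categories -/

variable {S : TwoCatOfCats.{w}}

/-- The 2-cells are all natural transformations, so their universal property carries over verbatim.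
What remains is that the factorizing functor is a 1-cell, which is `hlift`. -/
theorem IsProduct.of_CAT {I : Type w} {X : I → S.Obj} {P : S.Obj}
    {π : ∀ i, S.cat P ⥤ S.cat (X i)}
    (h : CAT.{w}.IsProduct (fun i => S.cat (X i)) (S.cat P) π) (hπ : ∀ i, S.mor (π i))
    (hlift : ∀ (T : S.Obj) (H : S.cat T ⥤ S.cat P), (∀ i, S.mor (H ⋙ π i)) → S.mor H) :
    S.IsProduct X P π where
  mor_proj := hπ
  existsUnique_lift T Q hQ := by
    obtain ⟨H, ⟨-, hH⟩, huniq⟩ := h.existsUnique_lift (S.cat T) Q fun _ => trivial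
    exact ⟨H, ⟨hlift T H fun i => by rw [hH]; exact hQ i, hH⟩,
      fun H' hH' => huniq H' ⟨trivial, hH'.2⟩⟩
  existsUnique_lift₂ T H H' _ _ α := h.existsUnique_lift₂ (S.cat T) H H' trivial trivial α

theorem IsInserter.of_CAT {K L : S.Obj} {F G : S.cat K ⥤ S.cat L} {N : S.Obj}
    {P : S.cat N ⥤ S.cat K} {φ : P ⋙ F ⟶ P ⋙ G}
    (h : CAT.{w}.IsInserter (K := S.cat K) (L := S.cat L) F G (S.cat N) P φ) (hP : S.mor P)
    (hlift : ∀ (T : S.Obj) (H : S.cat T ⥤ S.cat N), S.mor (H ⋙ P) → S.mor H) :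
    S.IsInserter F G N P φ where
  mor_proj := hP
  existsUnique_lift T H hH ψ := by
    obtain ⟨H', ⟨-, e, he⟩, huniq⟩ := h.existsUnique_lift (S.cat T) H trivial ψ
    exact ⟨H', ⟨hlift T H' (e.symm ▸ hH), e, he⟩, fun H'' hH'' => huniq H'' ⟨trivial, hH''.2⟩⟩
  existsUnique_lift₂ T H H' _ _ α hα :=
    h.existsUnique_lift₂ (S.cat T) H H' trivial trivial α hα

theorem IsEquifier.of_CAT {K L : S.Obj} {F G : S.cat K ⥤ S.cat L} {φ ψ : F ⟶ G} {E : S.Obj}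
    {P : S.cat E ⥤ S.cat K}
    (h : CAT.{w}.IsEquifier (K := S.cat K) (L := S.cat L) φ ψ (S.cat E) P) (hP : S.mor P)
    (hlift : ∀ (T : S.Obj) (H : S.cat T ⥤ S.cat E), S.mor (H ⋙ P) → S.mor H) :
    S.IsEquifier φ ψ E P where
  mor_proj := hP
  condition := h.condition
  existsUnique_lift T H hH e := by
    obtain ⟨H', ⟨-, he⟩, huniq⟩ := h.existsUnique_lift (S.cat T) H trivial e
    exact ⟨H', ⟨hlift T H' (he.symm ▸ hH), he⟩, fun H'' hH'' => huniq H'' ⟨trivial, hH''.2⟩⟩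
  existsUnique_lift₂ T H H' _ _ α := h.existsUnique_lift₂ (S.cat T) H H' trivial trivial α

end TwoCatOfCats

/-! ### Products, inserters and equifiers of categories -/

theorem isProduct_pi {I : Type w} (K : I → Type (w + 1)) [∀ i, Category.{w} (K i)] :
    CAT.{w}.IsProduct (fun i => Cat.of (K i)) (Cat.of (∀ i, K i)) (Pi.eval K) where
  mor_proj _ := trivial
  existsUnique_lift T Q _ := ⟨Functor.pi' Q, ⟨trivial, fun _ => rfl⟩, fun H hH =>
    Functor.pi_ext _ _ fun i => (hH.2 i).trans rfl⟩
  existsUnique_lift₂ T H H' _ _ α := by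
    refine ⟨{ app := fun t i => (α i).app t, naturality := fun s t f => ?_ }, fun _ => rfl,
      fun β hβ => ?_⟩
    · funext i
      exact (α i).naturality f
    · ext t
      funext i
      exact congrArg (fun γ => NatTrans.app γ t) (hβ i)

namespace Inserter

variable {K L : Type (w + 1)} [Category.{w} K] [Category.{w} L] {F G : K ⥤ L}

/-- The functor to the inserter induced by a 2-cell. -/
def lift {T : Type (w + 1)} [Category.{w} T] (H : T ⥤ K) (ψ : H ⋙ F ⟶ H ⋙ G) :
    T ⥤ Inserter F G where
  obj t := ⟨H.obj t, ψ.app t⟩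
  map f := ⟨H.map f, (ψ.naturality f).symm⟩

/-- The form that the compatibility condition of the inserter takes once the equation of functors
has been substituted. -/
theorem whiskerRight_eqToHom_iff {T : Type (w + 1)} [Category.{w} T] (H : T ⥤ K)
    (ψ ψ' : H ⋙ F ⟶ H ⋙ G) : ψ ≫ Functor.whiskerRight (eqToHom (rfl : H = H)) G =
      Functor.whiskerRight (eqToHom (rfl : H = H)) F ≫ ψ' ↔ ψ = ψ' := by
  simp

variable (F G) in
theorem isInserter :
    CAT.{w}.IsInserter (K := Cat.of K) (L := Cat.of L) F G (Cat.of (Inserter F G)) (forget F G)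
      (forgetHom F G) where
  mor_proj := trivial
  existsUnique_lift T H _ ψ := by
    refine ⟨lift H ψ, ⟨trivial, rfl, ?_⟩, ?_⟩
    · exact (whiskerRight_eqToHom_iff _ _ _).2 rfl
    · rintro H' ⟨-, rfl, h⟩
      obtain rfl := (whiskerRight_eqToHom_iff _ _ _).1 h
      rfl
  existsUnique_lift₂ T H H' _ _ α hα := by
    refine ⟨{ app := fun t => ⟨α.app t, congrArg (fun γ => NatTrans.app γ t) hα⟩
              naturality := fun s t f => hom_ext (α.naturality f) }, rfl, fun β hβ => ?_⟩
    exact NatTrans.ext (funext fun t => hom_ext (congrArg (fun γ => NatTrans.app γ t) hβ))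

end Inserter

section Equifier

variable {K L : Type (w + 1)} [Category.{w} K] [Category.{w} L] {F G : K ⥤ L} (φ ψ : F ⟶ G)

theorem isEquifier :
    CAT.{w}.IsEquifier (K := Cat.of K) (L := Cat.of L) φ ψ
      (Cat.of (equifierProperty φ ψ).FullSubcategory) (equifierProperty φ ψ).ι where
  mor_proj := trivial
  condition := by
    ext X
    exact X.property
  existsUnique_lift T H _ e :=
    ⟨(equifierProperty φ ψ).lift H fun t => congrArg (fun γ => NatTrans.app γ t) e,
      ⟨trivial, rfl⟩, by
        rintro H' ⟨-, rfl⟩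
        rfl⟩
  existsUnique_lift₂ T H H' _ _ α := by
    refine ⟨{ app := fun t => ObjectProperty.homMk (α.app t)
              naturality := fun s t f => ObjectProperty.hom_ext _ (α.naturality f) }, rfl,
      fun β hβ => ?_⟩
    exact NatTrans.ext (funext fun t =>
      ObjectProperty.hom_ext _ (congrArg (fun γ => NatTrans.app γ t) hβ))

end Equifier

/-! ### The 1-cells -/

theorem isAccessible_of_preservesFilteredColimits {K L : Type (w + 1)} [Category.{w} K]
    [Category.{w} L] (F : K ⥤ L) (hF : PreservesFilteredColimitsOfSize.{w, w} F) :
    Functor.IsAccessible.{w} F := by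
  have := Cardinal.fact_isRegular_aleph0.{w}
  have : F.IsCardinalAccessible Cardinal.aleph0.{w} := ⟨fun J _ _ =>
    haveI := isFiltered_of_isCardinalFiltered J Cardinal.aleph0.{w}
    hF.preserves_filtered_colimits J⟩
  exact Functor.isAccessible_of_isCardinalAccessible F Cardinal.aleph0.{w}

/-- A conservative functor reflects those colimits that exist in its source and are preserved by it,
so `H` preserves the `κ`-filtered colimits that `H ⋙ P` preserves. -/
theorem isAccessible_of_comp {T N K : Type (w + 1)} [Category.{w} T] [Category.{w} N]
    [Category.{w} K] (P : N ⥤ K) [P.ReflectsIsomorphisms] (hN : HasFilteredColimitsOfSize.{w, w} N)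
    (hP : PreservesFilteredColimitsOfSize.{w, w} P) (H : T ⥤ N)
    (hH : Functor.IsAccessible.{w} (H ⋙ P)) : Functor.IsAccessible.{w} H := by
  obtain ⟨κ, _, _⟩ := hH.exists_cardinal
  have : H.IsCardinalAccessible κ := ⟨fun J _ _ =>
    haveI := isFiltered_of_isCardinalFiltered J κ
    preservesFilteredColimits_of_comp P hN hP J H
      ((H ⋙ P).preservesColimitsOfShape_of_isCardinalAccessible κ J)⟩
  exact H.isAccessible_of_isCardinalAccessible κ

theorem isAccessible_pi {T : Type (w + 1)} [Category.{w} T] {I : Type w} {K : I → Type (w + 1)}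
    [∀ i, Category.{w} (K i)] (H : T ⥤ ∀ i, K i)
    (hH : ∀ i, Functor.IsAccessible.{w} (H ⋙ Pi.eval K i)) :
    Functor.IsAccessible.{w} H := by
  choose κ hκ h using fun i => (hH i).exists_cardinal
  -- The components may be accessible at different cardinals; as `I` is a set, one regular cardinal
  -- bounds them all. Each `κ i` enters as a type of that cardinality.
  obtain ⟨κ', hκ', hlt⟩ := HasCardinalLT.exists_regular_cardinal_forall.{w} fun i => (κ i).ord.ToType
  have : Fact κ'.IsRegular := ⟨hκ'⟩
  have hle : ∀ i, κ i ≤ κ' := fun i => by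
    have := hlt i
    rw [hasCardinalLT_iff_cardinal_mk_lt] at this
    simpa using this.le
  have : H.IsCardinalAccessible κ' := ⟨fun J _ _ => pi_preservesColimitsOfShape J H fun i =>
    haveI := (H ⋙ Pi.eval K i).isCardinalAccessible_of_le (hle i)
    (H ⋙ Pi.eval K i).preservesColimitsOfShape_of_isCardinalAccessible κ' J⟩
  exact H.isAccessible_of_isCardinalAccessible κ'

/-! ### Assembling the three limits -/

/-- The object of `ACC2` given by an accessible category with a coherent concrete functor. -/
def Acc2Obj.of {K : Type (w + 1)} [Category.{w} K] (hK : IsAccessibleCategory.{w} K)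
    {U : K ⥤ Type w} (hU : IsCoherentConcrete U) : Acc2Obj.{w} where
  cat := Cat.of K
  accessible := hK
  hasDirectedColimits := hU.hasFilteredColimits
  U := U
  faithful := hU.faithful
  preserves := hU.preserves
  coherent := hU.coherent
  concreteMonos _ _ f := ⟨hU.mono f, (mono_iff_injective _).2 (hU.injective f)⟩

theorem exists_product {I : Type w} (K : I → Acc2Obj.{w}) :
    ∃ (N : Acc2Obj.{w}) (π : ∀ i, N.cat ⥤ (K i).cat),
      ACC2.{w}.IsProduct K N π ∧
      ACC.{w}.IsProduct (fun i => (K i).toAccObj) N.toAccObj π ∧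
      CAT.{w}.IsProduct (fun i => (K i).cat) N.cat π := by
  have hU := fun i => (K i).isCoherentConcrete
  have h := isProduct_pi fun i => (K i).cat
  have hπ := pi_eval_preserves fun i => (hU i).hasFilteredColimits
  refine ⟨Acc2Obj.of (isAccessibleCategory_pi hU fun i => (K i).accessible)
    (isCoherentConcrete_disjointUnion hU), Pi.eval _, .of_CAT h hπ fun T H hH => ?_,
    .of_CAT h (fun i => isAccessible_of_preservesFilteredColimits _ (hπ i))
      fun T H hH => isAccessible_pi H hH, h⟩
  exact ⟨fun J _ _ => pi_preservesColimitsOfShape J H fun i => (hH i).preserves_filtered_colimits J⟩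

theorem exists_inserter (K L : Acc2Obj.{w}) (F G : K.cat ⥤ L.cat)
    (hF : PreservesFilteredColimitsOfSize.{w, w} F)
    (hG : PreservesFilteredColimitsOfSize.{w, w} G) :
    ∃ (N : Acc2Obj.{w}) (P : N.cat ⥤ K.cat) (φ : P ⋙ F ⟶ P ⋙ G),
      ACC2.{w}.IsInserter (K := K) (L := L) F G N P φ ∧
      ACC.{w}.IsInserter (K := K.toAccObj) (L := L.toAccObj) F G N.toAccObj P φ ∧
      CAT.{w}.IsInserter (K := K.cat) (L := L.cat) F G N.cat P φ := by
  have hU := K.isCoherentConcrete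
  have hV := L.isCoherentConcrete
  have h := Inserter.isInserter F G
  have hN := Inserter.isCoherentConcrete (G := G) hU hV hF
  have hP := Inserter.forget_preserves (G := G) hU.hasFilteredColimits hF
  refine ⟨Acc2Obj.of (Inserter.isAccessibleCategory hU hV hF hG K.accessible) hN,
    Inserter.forget F G, Inserter.forgetHom F G, .of_CAT h hP fun T H hH => ?_,
    .of_CAT h (isAccessible_of_preservesFilteredColimits _ hP)
      fun T H hH => isAccessible_of_comp _ hN.hasFilteredColimits hP H hH, h⟩
  exact ⟨fun J _ _ => preservesFilteredColimits_of_comp _ hN.hasFilteredColimits hP J H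
    (hH.preserves_filtered_colimits J)⟩

theorem exists_equifier (K L : Acc2Obj.{w}) (F G : K.cat ⥤ L.cat)
    (hF : PreservesFilteredColimitsOfSize.{w, w} F) (φ ψ : F ⟶ G) :
    ∃ (N : Acc2Obj.{w}) (P : N.cat ⥤ K.cat),
      ACC2.{w}.IsEquifier (K := K) (L := L) φ ψ N P ∧
      ACC.{w}.IsEquifier (K := K.toAccObj) (L := L.toAccObj) φ ψ N.toAccObj P ∧
      CAT.{w}.IsEquifier (K := K.cat) (L := L.cat) φ ψ N.cat P := by
  have hU := K.isCoherentConcrete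
  have hV := L.isCoherentConcrete
  have h := isEquifier φ ψ
  have hN := isCoherentConcrete_equifier φ ψ hU hF
  have hP := equifier_ι_preserves φ ψ hU.hasFilteredColimits hF
  refine ⟨Acc2Obj.of (isAccessibleCategory_equifier φ ψ hU hF hV K.accessible) hN,
    (equifierProperty φ ψ).ι, .of_CAT h hP fun T H hH => ?_,
    .of_CAT h (isAccessible_of_preservesFilteredColimits _ hP)
      fun T H hH => isAccessible_of_comp _ hN.hasFilteredColimits hP H hH, h⟩
  exact ⟨fun J _ _ => preservesFilteredColimits_of_comp _ hN.hasFilteredColimits hP J H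
    (hH.preserves_filtered_colimits J)⟩

theorem theorem2p5 :
    -- products
    (∀ (I : Type w) (K : I → Acc2Obj.{w}),
      ∃ (N : Acc2Obj.{w}) (π : ∀ i, N.cat ⥤ (K i).cat),
        ACC2.{w}.IsProduct K N π ∧
        ACC.{w}.IsProduct (fun i => (K i).toAccObj) N.toAccObj π ∧
        CAT.{w}.IsProduct (fun i => (K i).cat) N.cat π) ∧
    -- inserters
    (∀ (K L : Acc2Obj.{w}) (F G : K.cat ⥤ L.cat),
      PreservesFilteredColimitsOfSize.{w, w} F → PreservesFilteredColimitsOfSize.{w, w} G →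
      ∃ (N : Acc2Obj.{w}) (P : N.cat ⥤ K.cat) (φ : P ⋙ F ⟶ P ⋙ G),
        ACC2.{w}.IsInserter (K := K) (L := L) F G N P φ ∧
        ACC.{w}.IsInserter (K := K.toAccObj) (L := L.toAccObj) F G N.toAccObj P φ ∧
        CAT.{w}.IsInserter (K := K.cat) (L := L.cat) F G N.cat P φ) ∧
    -- equifiers
    (∀ (K L : Acc2Obj.{w}) (F G : K.cat ⥤ L.cat),
      PreservesFilteredColimitsOfSize.{w, w} F → PreservesFilteredColimitsOfSize.{w, w} G →
      ∀ φ ψ : F ⟶ G, ∃ (N : Acc2Obj.{w}) (P : N.cat ⥤ K.cat),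
        ACC2.{w}.IsEquifier (K := K) (L := L) φ ψ N P ∧
        ACC.{w}.IsEquifier (K := K.toAccObj) (L := L.toAccObj) φ ψ N.toAccObj P ∧
        CAT.{w}.IsEquifier (K := K.cat) (L := L.cat) φ ψ N.cat P) :=
  ⟨fun _ K => exists_product K, exists_inserter,
    fun K L F G hF _ φ ψ => exists_equifier K L F G hF φ ψ⟩
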